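/- Let $X_o$ be a compact Hausdorff space and let $\theta_o$ be a homeomorphism of $X_o$ that is uniquely ergodic, i.e. there is exactly one regular Borel probability measure $\mu_o$ on $X_o$ with $\mu_o\circ\theta_o^{-1}=\mu_o$. Let $f\in C(X_o;\mathbb T)$, where $\mathbb T=\{z\in\mathbb C:|z|=1\}$, let $\Phi_{\theta_o,f}$ be the Anzai skew-product, i.e. the homeomorphism $\Phi_{\theta_o,f}(x,z)=(\theta_o(x),f(x)z)$ of $X_o\times\mathbb T$, and let $\alpha(h)=h\circ\Phi_{\theta_o,f}$ be the induced $*$-automorphism of the $C^*$-algebra $C(X_o\times\mathbb T)$ of continuous complex-valued functions, with fixed-point subalgebra $C(X_o\times\mathbb T)^{\alpha}=\{h:\alpha(h)=h\}$. Then the following are equivalent: (i) $\Phi_{\theta_o,f}$ is uniquely ergodic with respect to the fixed-point subalgebra, i.e. for every $h\in C(X_o\times\mathbb T)$ the sequence of Cesàro averages $\frac1n\sum_{k=0}^{n-1}\alpha^k(h)$ converges in norm; (ii) there exists exactly one $\Phi_{\theta_o,f}$-invariant conditional expectation of $C(X_o\times\mathbb T)$ onto the fixed-point subalgebra, i.e.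 exactly one positive linear map $E\colon C(X_o\times\mathbb T)\to C(X_o\times\mathbb T)^{\alpha}$ with $E(b)=b$ and $E(bh)=bE(h)$ for all $b\in C(X_o\times\mathbb T)^{\alpha}$ and $h\in C(X_o\times\mathbb T)$, and with $E\circ\alpha=E$. -/

import Mathlib

open MeasureTheory Filter Topology
open scoped ComplexOrder

/-- The pair `(X, θ)` is uniquely ergodic with unique invariant measure `μ`: `μ` is a
`θ`-invariant regular Borel probability measure, and it is the only one. -/
structure IsUniquelyErgodic {X : Type*} [TopologicalSpace X] [MeasurableSpace X]
    (θ : X ≃ₜ X) (μ : Measure X) : Prop where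
  isProbabilityMeasure : IsProbabilityMeasure μ
  regular : μ.Regular
  map_eq : μ.map θ = μ
  eq_of_map_eq : ∀ ν : Measure X, IsProbabilityMeasure ν → ν.Regular → ν.map θ = ν → ν = μ

/-- The Anzai skew-product `Φ_{θ,f}(x, z) = (θ x, f x * z)`, a homeomorphism of `X × 𝕋`. -/
noncomputable def anzaiSkewProduct {X : Type*} [TopologicalSpace X] (θ : X ≃ₜ X) (f : C(X, Circle)) :
    X × Circle ≃ₜ X × Circle where
  toFun p := (θ p.1, f p.1 * p.2)
  invFun p := (θ.symm p.1, (f (θ.symm p.1))⁻¹ * p.2)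
  left_inv p := by simp
  right_inv p := by simp
  continuous_toFun := by fun_prop
  continuous_invFun := by fun_prop

/-- The `*`-automorphism `g ↦ g ∘ Φ` of `C(Y)` induced by a homeomorphism `Φ` of `Y`. -/
noncomputable def compAutomorphism {Y : Type*} [TopologicalSpace Y] (Φ : Y ≃ₜ Y) :
    C(Y, ℂ) ≃⋆ₐ[ℂ] C(Y, ℂ) :=
  Φ.compStarAlgEquiv' ℂ ℂ

/-- The fixed-point subalgebra `A^α = {a ∈ A | α a = a}` of a `*`-automorphism. -/
def fixedPointSubalgebra {A : Type*} [CStarAlgebra A] (α : A ≃⋆ₐ[ℂ] A) :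
    StarSubalgebra ℂ A where
  carrier := {a | α a = a}
  mul_mem' {a b} ha hb := by
    simp only [Set.mem_ofPred_eq] at ha hb ⊢
    rw [map_mul, ha, hb]
  add_mem' {a b} ha hb := by
    simp only [Set.mem_ofPred_eq] at ha hb ⊢
    rw [map_add, ha, hb]
  algebraMap_mem' r := by
    simp only [Set.mem_ofPred_eq, Algebra.algebraMap_eq_smul_one]
    rw [map_smul, map_one]
  star_mem' {a} ha := by
    simp only [Set.mem_ofPred_eq] at ha ⊢
    rw [map_star, ha]

/-- `(A, α)` is uniquely ergodic with respect to the fixed-point subalgebra: for each `a ∈ A` the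
Cesàro averages `(1/n) ∑_{k<n} α^k(a)` converge in norm. -/
def IsUniquelyErgodicRelFixedPoints {A : Type*} [CStarAlgebra A] (α : A ≃⋆ₐ[ℂ] A) : Prop :=
  ∀ a : A, ∃ b : A,
    Tendsto (fun n : ℕ => (n : ℂ)⁻¹ • ∑ k ∈ Finset.range n, (⇑α)^[k] a) atTop (𝓝 b)

/-- A linear map `E : A → B` is a conditional expectation of the unital `C*`-algebra `A` onto its
unital `*`-subalgebra `B`: a positive projection onto `B` that is a `B`-bimodule map.
(Unitality, complete positivity and contractivity follow.) -/
structure IsConditionalExpectation {A : Type*} [CStarAlgebra A] [PartialOrder A]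
    [StarOrderedRing A] (B : StarSubalgebra ℂ A) (E : A →ₗ[ℂ] B) : Prop where
  apply_coe : ∀ b : B, E (b : A) = b
  nonneg : ∀ a : A, 0 ≤ a → 0 ≤ (E a : A)
  map_coe_mul : ∀ (b : B) (a : A), E ((b : A) * a) = b * E a
  map_mul_coe : ∀ (a : A) (b : B), E (a * (b : A)) = E a * b

/-- `E` is an `α`-invariant conditional expectation onto the fixed-point subalgebra of `α`:
`E ∘ α = E`. -/
def IsInvariantConditionalExpectation {A : Type*} [CStarAlgebra A] [PartialOrder A]
    [StarOrderedRing A] (α : A ≃⋆ₐ[ℂ] A) (E : A →ₗ[ℂ] fixedPointSubalgebra α) : Prop :=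
  IsConditionalExpectation (fixedPointSubalgebra α) E ∧ ∀ a : A, E (α a) = E a

/-! (i) ⇒ (ii): write `A_N` for the Cesàro averages. Their limit `P` is an invariant conditional
expectation, and any other one `E'` satisfies `E' a = E' (A_N a) → E' (P a) = P a`.

(ii) ⇒ (i): the averages are contractions, so it suffices to treat the monomials `g(x) zⁿ`, whose
span is dense. On degree `n` the dynamics is the weighted Koopman operator `V g = fⁿ · (g ∘ θ)`.

If `V` fixes some `u ≠ 0`, then `|u|²` is `θ`-invariant, hence constant. So `u` is invertible, `g
zⁿ` is the fixed element `u zⁿ` times a function of the base, and unique ergodicity of `θ` gives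
convergence (`exists_tendsto_fiberMonomial`).

If `V` has no nonzero fixed function, the averages tend to `0`. By uniqueness `E` commutes with
fibre rotations, so it preserves degree and kills degree `n`. Along an ultrafilter, `P h = lim E (h
* A_N c)` exists, where `c` is the real or imaginary part of `g zⁿ`. For small `r > 0` the map `E +
r P` is again an invariant conditional expectation, so `P = 0` (`tendsto_zero_of_isSelfAdjoint`).
Recombining the two parts and taking `h = star (g zⁿ)`, the correlations of `g` with its averages
under `V` vanish in the limit. A recursion turns this into mean-square convergence
(`tendsto_integral_norm_sq`), and averaging once more under the uniquely ergodic `θ` makes it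
uniform (`IsUniquelyErgodic.tendsto_cesaroAverage_zero`). -/

/-! ### Cesàro averages of contractions -/

section Cesaro

/-- The Cesàro averages `(1/N) ∑_{k<N} T^k` of an endomorphism `T`. -/
noncomputable def cesaroAverage {A : Type*} [AddCommGroup A] [Module ℂ A] (T : A →ₗ[ℂ] A) (N : ℕ) :
    A →ₗ[ℂ] A :=
  (N : ℂ)⁻¹ • ∑ k ∈ Finset.range N, T ^ k

theorem cesaroAverage_apply {A : Type*} [AddCommGroup A] [Module ℂ A] (T : A →ₗ[ℂ] A) (N : ℕ)
    (a : A) : cesaroAverage T N a = (N : ℂ)⁻¹ • ∑ k ∈ Finset.range N, (T ^ k) a := by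
  simp [cesaroAverage]

theorem cesaroAverage_of_apply_eq_self {A : Type*} [AddCommGroup A] [Module ℂ A]
    {T : A →ₗ[ℂ] A} {a : A} (ha : T a = a) {N : ℕ} (hN : N ≠ 0) : cesaroAverage T N a = a := by
  have h : ∀ k, (T ^ k) a = a := fun k ↦ by
    induction k with
    | zero => simp
    | succ k ih => rw [pow_succ', Module.End.mul_apply, ih, ha]
  rw [cesaroAverage_apply, Finset.sum_congr rfl fun k _ ↦ h k, Finset.sum_const,
    Finset.card_range, ← Nat.cast_smul_eq_nsmul ℂ, smul_smul,
    inv_mul_cancel₀ (Nat.cast_ne_zero.2 hN), one_smul]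

/-- A linear map intertwining two endomorphisms intertwines their Cesàro averages. -/
theorem map_cesaroAverage {A B : Type*} [AddCommGroup A] [Module ℂ A] [AddCommGroup B] [Module ℂ B]
    {S : A →ₗ[ℂ] A} {T : B →ₗ[ℂ] B} (e : A →ₗ[ℂ] B) (h : ∀ a, e (S a) = T (e a)) (N : ℕ) (a : A) :
    e (cesaroAverage S N a) = cesaroAverage T N (e a) := by
  have hk : ∀ k, e ((S ^ k) a) = (T ^ k) (e a) := fun k ↦ by
    induction k with
    | zero => simp
    | succ k ih => rw [pow_succ', pow_succ', Module.End.mul_apply, h, ih, Module.End.mul_apply]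
  simp only [cesaroAverage_apply, map_smul, map_sum, hk]

theorem apply_cesaroAverage {A : Type*} [AddCommGroup A] [Module ℂ A] (T : A →ₗ[ℂ] A) (N : ℕ)
    (a : A) : T (cesaroAverage T N a) = cesaroAverage T N (T a) :=
  map_cesaroAverage T (fun _ ↦ rfl) N a

variable {A : Type*} [NormedAddCommGroup A] [NormedSpace ℂ A] {T : A →ₗ[ℂ] A}

theorem norm_pow_apply_le_of_contraction (hT : ∀ a, ‖T a‖ ≤ ‖a‖) (k : ℕ) (a : A) :
    ‖(T ^ k) a‖ ≤ ‖a‖ := by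
  induction k with
  | zero => simp
  | succ k ih => rw [pow_succ', Module.End.mul_apply]; exact (hT _).trans ih

theorem norm_cesaroAverage_le (hT : ∀ a, ‖T a‖ ≤ ‖a‖) (N : ℕ) (a : A) :
    ‖cesaroAverage T N a‖ ≤ ‖a‖ := by
  rcases eq_or_ne N 0 with rfl | hN
  · simp [cesaroAverage_apply]
  rw [cesaroAverage_apply, norm_smul, norm_inv, Complex.norm_natCast, inv_mul_le_iff₀ (by positivity)]
  refine (norm_sum_le_of_le _ fun k _ ↦ norm_pow_apply_le_of_contraction hT k a).trans ?_
  simp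

theorem cesaroAverage_apply_sub (T : A →ₗ[ℂ] A) (N : ℕ) (a : A) :
    cesaroAverage T N (T a) - cesaroAverage T N a = (N : ℂ)⁻¹ • ((T ^ N) a - a) := by
  rw [cesaroAverage_apply, cesaroAverage_apply, ← smul_sub, ← Finset.sum_sub_distrib]
  have := Finset.sum_range_sub (fun k ↦ (T ^ k) a) N
  simp only [pow_zero, Module.End.one_apply] at this
  rw [← this]
  simp only [pow_succ, Module.End.mul_apply]

theorem tendsto_cesaroAverage_apply_sub (hT : ∀ a, ‖T a‖ ≤ ‖a‖) (a : A) :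
    Tendsto (fun N ↦ cesaroAverage T N (T a) - cesaroAverage T N a) atTop (𝓝 0) := by
  have h0 : Tendsto (fun N : ℕ ↦ (N : ℝ)⁻¹ * (2 * ‖a‖)) atTop (𝓝 0) := by
    simpa using (tendsto_inv_atTop_nhds_zero_nat (𝕜 := ℝ)).mul_const (2 * ‖a‖)
  refine squeeze_zero_norm (fun N ↦ ?_) h0
  rw [cesaroAverage_apply_sub, norm_smul, norm_inv, Complex.norm_natCast]
  gcongr
  calc _ ≤ ‖(T ^ N) a‖ + ‖a‖ := norm_sub_le _ _
    _ ≤ 2 * ‖a‖ := by linarith [norm_pow_apply_le_of_contraction hT N a]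

/-- By telescoping, each `T ^ k a` has the same asymptotic averages as `a`, hence so does any finite
average of them. This lets a well-chosen `A_M a` replace `a`. -/
theorem tendsto_cesaroAverage_cesaroAverage_sub (hT : ∀ a, ‖T a‖ ≤ ‖a‖) (a : A) {M : ℕ}
    (hM : M ≠ 0) :
    Tendsto (fun N ↦ cesaroAverage T N (cesaroAverage T M a) - cesaroAverage T N a)
      atTop (𝓝 0) := by
  have hk : ∀ k, Tendsto (fun N ↦ cesaroAverage T N ((T ^ k) a) - cesaroAverage T N a)
      atTop (𝓝 0) := fun k ↦ by
    induction k with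
    | zero => simp
    | succ k ih =>
      have := (tendsto_cesaroAverage_apply_sub hT ((T ^ k) a)).add ih
      simpa [pow_succ', Module.End.mul_apply] using this
  have h := (tendsto_finsetSum (Finset.range M) fun k _ ↦ hk k).const_smul (M : ℂ)⁻¹
  simp only [Finset.sum_const_zero, smul_zero] at h
  refine h.congr fun N ↦ ?_
  rw [cesaroAverage_apply T M, map_smul, map_sum, Finset.sum_sub_distrib, smul_sub,
    Finset.sum_const, Finset.card_range, ← Nat.cast_smul_eq_nsmul ℂ, smul_smul,
    inv_mul_cancel₀ (Nat.cast_ne_zero.2 hM), one_smul]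

/-- A uniformly bounded family of linear maps that converges on a set with dense span converges
everywhere. -/
theorem exists_tendsto_of_dense_span {B ι : Type*} [NormedAddCommGroup B] [NormedSpace ℂ B]
    [CompleteSpace B] {l : Filter ι} [l.NeBot] {F : ι → A →ₗ[ℂ] B} {C : ℝ}
    (hF : ∀ i a, ‖F i a‖ ≤ C * ‖a‖) {s : Set A} (hs : Dense (Submodule.span ℂ s : Set A))
    (h : ∀ a ∈ s, ∃ b, Tendsto (fun i ↦ F i a) l (𝓝 b)) (a : A) :
    ∃ b, Tendsto (fun i ↦ F i a) l (𝓝 b) := by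
  have hspan : ∀ a ∈ Submodule.span ℂ s, ∃ b, Tendsto (fun i ↦ F i a) l (𝓝 b) := fun a ha ↦ by
    induction ha using Submodule.span_induction with
    | mem x hx => exact h x hx
    | zero => exact ⟨0, by simp⟩
    | add x y _ _ hx hy =>
      obtain ⟨b, hb⟩ := hx
      obtain ⟨c, hc⟩ := hy
      exact ⟨b + c, by simpa using hb.add hc⟩
    | smul r x _ hx =>
      obtain ⟨b, hb⟩ := hx
      exact ⟨r • b, by simpa using hb.const_smul r⟩
  have hC : 0 < |C| + 1 := by positivity
  refine cauchy_map_iff_exists_tendsto.1 (Metric.cauchy_iff.2 ⟨inferInstance, fun ε hε ↦ ?_⟩)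
  -- Four errors of `ε / 4`: two from replacing `a` by `a'`, two from the limit `b`. No sign of `C`
  -- is known, hence `|C| + 1`.
  obtain ⟨a', ha', hd⟩ := Metric.dense_iff.1 hs a (ε / (4 * (|C| + 1))) (by positivity)
  obtain ⟨b, hb⟩ := hspan a' hd
  refine ⟨_, image_mem_map (Metric.tendsto_nhds.1 hb (ε / 4) (by positivity)), ?_⟩
  have key : ∀ i, dist (F i a) (F i a') ≤ ε / 4 := fun i ↦ by
    rw [dist_eq_norm, ← map_sub]
    rw [Metric.mem_ball, dist_comm, dist_eq_norm] at ha'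
    calc _ ≤ C * ‖a - a'‖ := hF _ _
      _ ≤ (|C| + 1) * (ε / (4 * (|C| + 1))) := by
        gcongr
        linarith [le_abs_self C]
      _ = ε / 4 := by field_simp
  rintro _ ⟨i, hi, rfl⟩ _ ⟨j, hj, rfl⟩
  simp only [Set.mem_ofPred_eq] at hi hj
  have h1 := dist_triangle4 (F i a) (F i a') (F j a') (F j a)
  have h2 := dist_triangle_right (F i a') (F j a') b
  have h3 := key i
  have h4 := key j
  rw [dist_comm] at h4
  linarith

/-- A real sequence whose increments are `o(N)` is itself `o(N²)`. -/
theorem tendsto_div_sq_of_sub_isLittleO {s : ℕ → ℝ}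
    (h : Tendsto (fun N : ℕ ↦ (s (N + 1) - s N) / (N + 1)) atTop (𝓝 0)) :
    Tendsto (fun N : ℕ ↦ s N / (N : ℝ) ^ 2) atTop (𝓝 0) := by
  have h1 := h.norm.cesaro
  have h2 : Tendsto (fun N : ℕ ↦ |s 0| * ((N : ℝ)⁻¹ * (N : ℝ)⁻¹)) atTop (𝓝 0) := by
    simpa using ((tendsto_inv_atTop_nhds_zero_nat (𝕜 := ℝ)).mul
      (tendsto_inv_atTop_nhds_zero_nat (𝕜 := ℝ))).const_mul |s 0|
  have h3 := h2.add h1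
  simp only [norm_zero, add_zero] at h3
  refine squeeze_zero_norm (fun N ↦ ?_) h3
  rcases eq_or_ne N 0 with rfl | hN
  · simp
  -- Telescope and use `i + 1 ≤ N`; after division by `N²` the sum becomes a Cesàro mean of a null
  -- sequence.
  have hb : |s N| ≤ |s 0| + N * ∑ i ∈ Finset.range N, ‖(s (i + 1) - s i) / (i + 1)‖ := by
    have : s N = s 0 + ∑ i ∈ Finset.range N, (s (i + 1) - s i) := by
      rw [Finset.sum_range_sub]; ring
    rw [this]
    refine (abs_add_le _ _).trans ?_
    gcongr
    refine (Finset.abs_sum_le_sum_abs _ _).trans ?_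
    rw [Finset.mul_sum]
    refine Finset.sum_le_sum fun i hi ↦ ?_
    rw [Real.norm_eq_abs, abs_div, abs_of_pos (by positivity : (0 : ℝ) < i + 1),
      mul_div_assoc', le_div_iff₀ (by positivity), mul_comm]
    gcongr
    exact_mod_cast Finset.mem_range.1 hi
  rw [Real.norm_eq_abs, abs_div, abs_of_pos (by positivity : (0 : ℝ) < (N : ℝ) ^ 2),
    div_le_iff₀ (by positivity)]
  refine hb.trans (le_of_eq ?_)
  field_simp

end Cesaro

/-! ### Uniform convergence for uniquely ergodic homeomorphisms -/

/-- Ultrafilters replace diagonal subsequences, since `C(X)` need not be separable. -/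
theorem Ultrafilter.exists_tendsto_of_forall_mem {ι Z : Type*} [TopologicalSpace Z] (𝒰 : Ultrafilter ι)
    {K : Set Z} (hK : IsCompact K) {u : ι → Z} (hu : ∀ i, u i ∈ K) :
    ∃ z ∈ K, Tendsto u 𝒰 (𝓝 z) :=
  isCompact_iff_ultrafilter_le_nhds.1 hK (𝒰.map u)
    (le_principal_iff.2 <| Filter.mem_map.2 <| univ_mem' hu)

section UniqueErgodicity

variable {X : Type*} [TopologicalSpace X] [CompactSpace X] [T2Space X]
  [MeasurableSpace X] [BorelSpace X] {θ : X ≃ₜ X} {μ : Measure X}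

/-- For a uniquely ergodic measure, every limit of empirical averages along an ultrafilter is
integration against that measure. -/
theorem IsUniquelyErgodic.tendsto_empirical (hμ : IsUniquelyErgodic θ μ) {𝒰 : Ultrafilter ℕ}
    (h𝒰 : (𝒰 : Filter ℕ) ≤ atTop) (x : ℕ → X) (g : C(X, ℝ)) :
    Tendsto (fun N : ℕ ↦ (N : ℝ)⁻¹ * ∑ k ∈ Finset.range N, g (θ^[k] (x N))) 𝒰
      (𝓝 (∫ y, g y ∂μ)) := by
  set a : C(X, ℝ) → ℕ → ℝ := fun g N ↦ (N : ℝ)⁻¹ * ∑ k ∈ Finset.range N, g (θ^[k] (x N)) with ha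
  have hne : ∀ᶠ N : ℕ in 𝒰, N ≠ 0 := h𝒰 (eventually_ne_atTop 0)
  have hbd : ∀ g N, a g N ∈ Metric.closedBall (0 : ℝ) ‖g‖ := fun g N ↦ by
    rw [mem_closedBall_zero_iff, ha]
    simp only [norm_mul, norm_inv, Real.norm_natCast]
    rcases eq_or_ne N 0 with rfl | hN
    · simp
    rw [inv_mul_le_iff₀ (by positivity)]
    exact (norm_sum_le_of_le _ fun k _ ↦ g.norm_coe_le_norm _).trans (by simp)
  -- `Λ` is a positive, normalised, `θ`-invariant functional, so its Riesz measure is an invariant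
  -- probability measure and must be `μ`.
  choose Λ hΛ using fun g ↦ 𝒰.exists_tendsto_of_forall_mem (isCompact_closedBall _ _) (hbd g)
  replace hΛ := fun g ↦ (hΛ g).2
  have hadd : ∀ g h, Λ (g + h) = Λ g + Λ h := fun g h ↦
    tendsto_nhds_unique (hΛ _) (((hΛ g).add (hΛ h)).congr fun N ↦ by
      simp [ha, Finset.sum_add_distrib, mul_add])
  have hsmul : ∀ (c : ℝ) g, Λ (c • g) = c • Λ g := fun c g ↦
    tendsto_nhds_unique (hΛ _) (((hΛ g).const_smul c).congr fun N ↦ by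
      simp [ha, ← Finset.mul_sum, mul_left_comm])
  have hmono : ∀ g h : C(X, ℝ), g ≤ h → Λ g ≤ Λ h := fun g h hgh ↦
    le_of_tendsto_of_tendsto' (hΛ g) (hΛ h) fun N ↦ by
      simp only [ha]
      gcongr
      exact hgh _
  have hone : Λ 1 = 1 :=
    tendsto_nhds_unique (hΛ 1) (tendsto_const_nhds.congr' (hne.mono fun N hN ↦ by
      simp [ha, hN]))
  have hinv : ∀ g : C(X, ℝ), Λ (g.comp θ) = Λ g := fun g ↦ by
    have h0 : Tendsto (fun N : ℕ ↦ (N : ℝ)⁻¹ * (2 * ‖g‖)) 𝒰 (𝓝 0) := by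
      simpa using ((tendsto_inv_atTop_nhds_zero_nat (𝕜 := ℝ)).mul_const (2 * ‖g‖)).mono_left h𝒰
    refine sub_eq_zero.1 (tendsto_nhds_unique ((hΛ _).sub (hΛ g)) (squeeze_zero_norm (fun N ↦ ?_) h0))
    -- Only the two end terms survive, bounded independently of the base point, so `x N` may vary
    -- with `N`.
    have hs : a (g.comp θ) N - a g N = (N : ℝ)⁻¹ * (g (θ^[N] (x N)) - g (x N)) := by
      simp only [ha, ← mul_sub, ← Finset.sum_sub_distrib]
      have := Finset.sum_range_sub (fun k ↦ g (θ^[k] (x N))) N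
      simp only [Function.iterate_succ_apply', Function.iterate_zero, id_eq] at this
      rw [← this]
      rfl
    rw [hs, norm_mul, norm_inv, Real.norm_natCast]
    gcongr
    refine (norm_sub_le _ _).trans ?_
    linarith [g.norm_coe_le_norm (θ^[N] (x N)), g.norm_coe_le_norm (x N)]
  let L : CompactlySupportedContinuousMap X ℝ →ₚ[ℝ] ℝ :=
    { toFun g := Λ g
      map_add' g h := hadd g h
      map_smul' c g := hsmul c g
      monotone' g h hgh := hmono g h hgh }
  let ν := RealRMK.rieszMeasure L
  have hν : ∀ g : C(X, ℝ), ∫ y, g y ∂ν = Λ g := fun g ↦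
    RealRMK.integral_rieszMeasure L (CompactlySupportedContinuousMap.continuousMapEquiv g)
  have hreg : ν.Regular := RealRMK.regular_rieszMeasure L
  have hfin : IsFiniteMeasure ν := inferInstanceAs (IsFiniteMeasure (RealRMK.rieszMeasure L))
  have hprob : IsProbabilityMeasure ν := by
    have h1 := hν 1
    simp only [ContinuousMap.one_apply, integral_const, smul_eq_mul, mul_one, hone] at h1
    exact ⟨(ENNReal.toReal_eq_one_iff _).1 h1⟩
  have hmap : ν.map θ = ν := by
    have := Measure.Regular.map (μ := ν) θ
    refine Measure.ext_of_integral_eq_on_compactlySupported fun g ↦ ?_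
    rw [integral_map θ.continuous.aemeasurable (map_continuous g).aestronglyMeasurable]
    exact (hν ((g : C(X, ℝ)).comp θ)).trans ((hinv _).trans (hν g).symm)
  rw [← hμ.eq_of_map_eq ν hprob hreg hmap, hν]
  exact hΛ g

/-- For a uniquely ergodic homeomorphism, ergodic averages of continuous functions converge
uniformly. -/
theorem IsUniquelyErgodic.eventually_forall_abs_lt (hμ : IsUniquelyErgodic θ μ) (g : C(X, ℝ)) {ε : ℝ}
    (hε : 0 < ε) : ∀ᶠ N : ℕ in atTop, ∀ x,
      |(N : ℝ)⁻¹ * ∑ k ∈ Finset.range N, g (θ^[k] x) - ∫ y, g y ∂μ| < ε := by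
  by_contra hcon
  have := hμ.isProbabilityMeasure
  have hX : Nonempty X := μ.nonempty_of_neZero
  set S : Set ℕ := {N | ∃ x,
    ε ≤ |(N : ℝ)⁻¹ * ∑ k ∈ Finset.range N, g (θ^[k] x) - ∫ y, g y ∂μ|} with hS
  have hfr : ∃ᶠ N in atTop, N ∈ S := by
    refine (not_eventually.1 hcon).mono fun N hN ↦ ?_
    push Not at hN
    exact hN
  have : (atTop ⊓ 𝓟 S).NeBot := frequently_mem_iff_neBot.1 hfr
  let 𝒰 := Ultrafilter.of (atTop ⊓ 𝓟 S)
  have h𝒰 : (𝒰 : Filter ℕ) ≤ atTop ⊓ 𝓟 S := Ultrafilter.of_le _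
  -- For `N ∉ S` the point `x N` is arbitrary; this is harmless because `S` belongs to `𝒰`.
  choose! x hx using fun N (hN : N ∈ S) ↦ hN
  have ht := hμ.tendsto_empirical (h𝒰.trans inf_le_left) x g
  obtain ⟨N, hN, hN'⟩ := ((Metric.tendsto_nhds.1 ht ε hε).and
    (le_principal_iff.1 (h𝒰.trans inf_le_right))).exists
  exact absurd (hx N hN') (not_le.2 hN)

end UniqueErgodicity

/-! ### Invariant conditional expectations of a `*`-automorphism -/

section CStarDynamics

variable {A : Type*} [CStarAlgebra A]

/-- A `*`-automorphism, as a linear endomorphism. -/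
def automorphismEnd (α : A ≃⋆ₐ[ℂ] A) : A →ₗ[ℂ] A where
  toFun := α
  map_add' := map_add α
  map_smul' := map_smul α

@[simp] theorem automorphismEnd_apply (α : A ≃⋆ₐ[ℂ] A) (a : A) : automorphismEnd α a = α a := rfl

theorem mem_fixedPointSubalgebra {α : A ≃⋆ₐ[ℂ] A} {a : A} :
    a ∈ fixedPointSubalgebra α ↔ α a = a := Iff.rfl

theorem norm_automorphismEnd_le (α : A ≃⋆ₐ[ℂ] A) (a : A) : ‖automorphismEnd α a‖ ≤ ‖a‖ :=
  NonUnitalStarAlgHom.norm_apply_le α a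

theorem continuous_automorphism (α : A ≃⋆ₐ[ℂ] A) : Continuous α :=
  (NonUnitalStarAlgHom.isometry α (EquivLike.injective α)).continuous

theorem isUniquelyErgodicRelFixedPoints_iff {α : A ≃⋆ₐ[ℂ] A} :
    IsUniquelyErgodicRelFixedPoints α ↔ ∀ a : A, ∃ b : A,
      Tendsto (fun N ↦ cesaroAverage (automorphismEnd α) N a) atTop (𝓝 b) := by
  simp only [IsUniquelyErgodicRelFixedPoints, cesaroAverage_apply, Module.End.pow_apply]
  rfl

/-- Cesàro averages of a `*`-automorphism are module maps over the fixed points. -/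
theorem cesaroAverage_mul_of_fixed {α : A ≃⋆ₐ[ℂ] A} {b : A} (hb : α b = b) (N : ℕ) (a : A) :
    cesaroAverage (automorphismEnd α) N (b * a) = b * cesaroAverage (automorphismEnd α) N a :=
  (map_cesaroAverage (LinearMap.mulLeft ℂ b) (fun a ↦ by simp [hb]) N a).symm

theorem cesaroAverage_mul_of_fixed_right {α : A ≃⋆ₐ[ℂ] A} {b : A} (hb : α b = b) (N : ℕ) (a : A) :
    cesaroAverage (automorphismEnd α) N (a * b) = cesaroAverage (automorphismEnd α) N a * b :=
  (map_cesaroAverage (LinearMap.mulRight ℂ b) (fun a ↦ by simp [hb]) N a).symm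

theorem star_automorphismEnd_pow (α : A ≃⋆ₐ[ℂ] A) (k : ℕ) (a : A) :
    star ((automorphismEnd α ^ k) a) = (automorphismEnd α ^ k) (star a) := by
  induction k with
  | zero => simp
  | succ k ih => simp [pow_succ', ← ih, map_star]

theorem star_cesaroAverage (α : A ≃⋆ₐ[ℂ] A) (N : ℕ) (a : A) :
    star (cesaroAverage (automorphismEnd α) N a) =
      cesaroAverage (automorphismEnd α) N (star a) := by
  simp [cesaroAverage_apply, star_automorphismEnd_pow]

variable [PartialOrder A] [StarOrderedRing A]

namespace IsInvariantConditionalExpectation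

variable {α : A ≃⋆ₐ[ℂ] A} {E : A →ₗ[ℂ] fixedPointSubalgebra α}

/-- Positive maps between `C*`-algebras are automatically bounded. -/
theorem exists_norm_le (hE : IsInvariantConditionalExpectation α E) :
    ∃ C : ℝ, 0 ≤ C ∧ ∀ a, ‖(E a : A)‖ ≤ C * ‖a‖ := by
  obtain ⟨C, hC⟩ := PositiveLinearMap.exists_norm_apply_le
    (PositiveLinearMap.mk₀ ((fixedPointSubalgebra α).subtype.toAlgHom.toLinearMap ∘ₗ E) hE.1.nonneg)
  exact ⟨C, C.2, hC⟩

theorem continuous (hE : IsInvariantConditionalExpectation α E) :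
    Continuous fun a ↦ (E a : A) := by
  obtain ⟨C, -, hC⟩ := hE.exists_norm_le
  exact (LinearMap.mkContinuous
    ((fixedPointSubalgebra α).subtype.toAlgHom.toLinearMap ∘ₗ E) C hC).continuous

theorem map_one (hE : IsInvariantConditionalExpectation α E) : E 1 = 1 := hE.1.apply_coe 1

/-- If `E (a * c i)` converges for all `a` in a set with dense span and `c` is bounded, it converges for
all `a`. -/
theorem exists_tendsto_apply_mul (hE : IsInvariantConditionalExpectation α E) {ι : Type*}
    {l : Filter ι} [l.NeBot] {c : ι → A} {K : ℝ} (hc : ∀ i, ‖c i‖ ≤ K) {s : Set A}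
    (hs : Dense (Submodule.span ℂ s : Set A))
    (h : ∀ a ∈ s, ∃ b : A, Tendsto (fun i ↦ (E (a * c i) : A)) l (𝓝 b)) (a : A) :
    ∃ b : A, Tendsto (fun i ↦ (E (a * c i) : A)) l (𝓝 b) := by
  obtain ⟨C, hC0, hC⟩ := hE.exists_norm_le
  let F : ι → A →ₗ[ℂ] A := fun i ↦
    (fixedPointSubalgebra α).subtype.toAlgHom.toLinearMap ∘ₗ E ∘ₗ LinearMap.mulRight ℂ (c i)
  have hF : ∀ i a, ‖F i a‖ ≤ C * K * ‖a‖ := fun i a ↦ by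
    refine (hC (a * c i)).trans ?_
    rw [mul_assoc, mul_comm K]
    gcongr
    exact (norm_mul_le _ _).trans (by gcongr; exact hc i)
  exact exists_tendsto_of_dense_span hF hs h a

theorem apply_cesaroAverage (hE : IsInvariantConditionalExpectation α E) {N : ℕ} (hN : N ≠ 0)
    (a : A) : E (cesaroAverage (automorphismEnd α) N a) = E a := by
  rw [map_cesaroAverage (T := LinearMap.id) E (fun a ↦ hE.2 a),
    cesaroAverage_of_apply_eq_self rfl hN]

end IsInvariantConditionalExpectation

/-- Norm convergence of the Cesàro averages gives a unique invariant conditional expectation, their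
limit. -/
theorem IsUniquelyErgodicRelFixedPoints.existsUnique {α : A ≃⋆ₐ[ℂ] A}
    (h : IsUniquelyErgodicRelFixedPoints α) :
    ∃! E : A →ₗ[ℂ] fixedPointSubalgebra α, IsInvariantConditionalExpectation α E := by
  rw [isUniquelyErgodicRelFixedPoints_iff] at h
  choose P hP using h
  -- `α (A_N a) = A_N (α a)`, which differs from `A_N a` by a null sequence.
  have hfix : ∀ a, α (P a) = P a := fun a ↦ by
    have h1 := ((continuous_automorphism α).tendsto _).comp (hP a)
    have h2 := (tendsto_cesaroAverage_apply_sub (norm_automorphismEnd_le α) a).add (hP a)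
    simp only [sub_add_cancel, zero_add] at h2
    refine tendsto_nhds_unique h1 (h2.congr fun N ↦ ?_)
    rw [← apply_cesaroAverage]
    rfl
  have hadd : ∀ a b, P (a + b) = P a + P b := fun a b ↦
    tendsto_nhds_unique (hP _) (((hP a).add (hP b)).congr fun N ↦ by simp)
  have hsmul : ∀ (c : ℂ) a, P (c • a) = c • P a := fun c a ↦
    tendsto_nhds_unique (hP _) (((hP a).const_smul c).congr fun N ↦ by simp)
  let E : A →ₗ[ℂ] fixedPointSubalgebra α :=
    { toFun a := ⟨P a, hfix a⟩
      map_add' a b := Subtype.ext (hadd a b)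
      map_smul' c a := Subtype.ext (hsmul c a) }
  have hpow : ∀ k (a : A), 0 ≤ a → 0 ≤ (automorphismEnd α ^ k) a := fun k a ha ↦ by
    induction k with
    | zero => simpa
    | succ k ih => rw [pow_succ']; exact map_nonneg α ih
  refine ⟨E, ⟨⟨fun b ↦ Subtype.ext ?_, fun a ha ↦ ?_, fun b a ↦ Subtype.ext ?_,
    fun a b ↦ Subtype.ext ?_⟩, fun a ↦ Subtype.ext ?_⟩, fun E' hE' ↦ LinearMap.ext fun a ↦
    Subtype.ext ?_⟩
  · exact tendsto_nhds_unique (hP _) (tendsto_const_nhds.congr' ((eventually_ne_atTop 0).mono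
      fun N hN ↦ (cesaroAverage_of_apply_eq_self (T := automorphismEnd α) b.2 hN).symm))
  · refine ge_of_tendsto' (hP a) fun N ↦ ?_
    rw [cesaroAverage_apply, ← Complex.ofReal_natCast, ← Complex.ofReal_inv, Complex.coe_smul]
    exact smul_nonneg (by positivity) (Finset.sum_nonneg fun k _ ↦ hpow k a ha)
  · exact tendsto_nhds_unique (hP _) (((hP a).const_mul (b : A)).congr fun N ↦
      (cesaroAverage_mul_of_fixed b.2 N a).symm)
  · exact tendsto_nhds_unique (hP _) (((hP a).mul_const (b : A)).congr fun N ↦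
      (cesaroAverage_mul_of_fixed_right b.2 N a).symm)
  · have h2 := (tendsto_cesaroAverage_apply_sub (norm_automorphismEnd_le α) a).add (hP a)
    simp only [sub_add_cancel, zero_add] at h2
    exact tendsto_nhds_unique (hP _) h2
  · have h1 := (hE'.continuous.tendsto _).comp (hP a)
    have h2 : E' (P a) = ⟨P a, hfix a⟩ := hE'.1.apply_coe ⟨P a, hfix a⟩
    rw [h2] at h1
    refine tendsto_nhds_unique (tendsto_const_nhds.congr' ?_) h1
    filter_upwards [eventually_ne_atTop 0] with N hN
    simp [hE'.apply_cesaroAverage hN]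

namespace IsInvariantConditionalExpectation

variable {α : A ≃⋆ₐ[ℂ] A} {E : A →ₗ[ℂ] fixedPointSubalgebra α}

/-- The unique invariant conditional expectation commutes with every automorphism that commutes with
the dynamics. -/
theorem apply_commuting_automorphism (hE : IsInvariantConditionalExpectation α E)
    (huniq : ∀ E', IsInvariantConditionalExpectation α E' → E' = E) {β : A ≃⋆ₐ[ℂ] A}
    (hβ : ∀ a, β (α a) = α (β a)) (a : A) : (E (β a) : A) = β (E a) := by
  have hβ' : ∀ a, β.symm (α a) = α (β.symm a) := fun a ↦ by
    refine (EquivLike.injective β) ?_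
    rw [hβ, β.apply_symm_apply, β.apply_symm_apply]
  have hfix : ∀ a, α (β.symm (E (β a))) = β.symm (E (β a)) := fun a ↦ by
    rw [← hβ', (E (β a)).2]
  have hfixβ : ∀ b : fixedPointSubalgebra α, α (β b) = β b := fun b ↦ by rw [← hβ, b.2]
  -- The conjugate `β⁻¹ ∘ E ∘ β` is again an invariant conditional expectation, hence equals `E`.
  let E' : A →ₗ[ℂ] fixedPointSubalgebra α :=
    { toFun a := ⟨β.symm (E (β a)), hfix a⟩
      map_add' a b := Subtype.ext (by simp)
      map_smul' c a := Subtype.ext (by simp) }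
  have hE' : IsInvariantConditionalExpectation α E' := by
    refine ⟨⟨fun b ↦ Subtype.ext ?_, fun a ha ↦ ?_, fun b a ↦ Subtype.ext ?_,
      fun a b ↦ Subtype.ext ?_⟩, fun a ↦ Subtype.ext ?_⟩
    · have := hE.1.apply_coe ⟨β b, hfixβ b⟩
      simp only at this
      simp [E', this]
    · exact map_nonneg β.symm (hE.1.nonneg _ (map_nonneg β ha))
    · have := hE.1.map_coe_mul ⟨β b, hfixβ b⟩ (β a)
      simp only at this
      simp [E', this]
    · have := hE.1.map_mul_coe (β a) ⟨β b, hfixβ b⟩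
      simp only at this
      simp [E', this]
    · simp [E', hβ, hE.2]
  have h1 : β.symm (E (β a)) = E a := congrArg Subtype.val (LinearMap.congr_fun (huniq E' hE') a)
  rw [← h1, β.apply_symm_apply]

/-- In a commutative algebra with a unique invariant conditional expectation `E`, perturbing `E` by the
density `1 + r • A_N c` shows that `E (h * A_N c)` can only converge to zero. -/
theorem tendsto_zero_of_isSelfAdjoint (hcomm : ∀ a b : A, a * b = b * a)
    (hE : IsInvariantConditionalExpectation α E)
    (huniq : ∀ E', IsInvariantConditionalExpectation α E' → E' = E) {l : Filter ℕ} [l.NeBot]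
    (hl : l ≤ atTop) {c : A} (hc : IsSelfAdjoint c) (hc0 : E c = 0)
    (hconv : ∀ h, ∃ b : A,
      Tendsto (fun N ↦ (E (h * cesaroAverage (automorphismEnd α) N c) : A)) l (𝓝 b)) (h : A) :
    Tendsto (fun N ↦ (E (h * cesaroAverage (automorphismEnd α) N c) : A)) l (𝓝 0) := by
  choose P hP using hconv
  have hne : ∀ᶠ N : ℕ in l, N ≠ 0 := hl (eventually_ne_atTop 0)
  have hfix : ∀ a, α (P a) = P a := fun a ↦
    tendsto_nhds_unique (((continuous_automorphism α).tendsto _).comp (hP a))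
      ((hP a).congr fun N ↦ ((E _).2).symm)
  have hadd : ∀ a b, P (a + b) = P a + P b := fun a b ↦
    tendsto_nhds_unique (hP _) (((hP a).add (hP b)).congr fun N ↦ by simp [add_mul])
  have hsmul : ∀ (r : ℂ) a, P (r • a) = r • P a := fun r a ↦
    tendsto_nhds_unique (hP _) (((hP a).const_smul r).congr fun N ↦ by simp)
  have hmul : ∀ (b : fixedPointSubalgebra α) a, P (b * a) = b * P a := fun b a ↦
    tendsto_nhds_unique (hP _) (((hP a).const_mul (b : A)).congr fun N ↦ by
      rw [mul_assoc, hE.1.map_coe_mul]; rfl)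
  -- Together with `hmul` this makes `P` vanish on fixed points, so adding a multiple of `P` to `E`
  -- keeps it a projection.
  have hone : P 1 = 0 :=
    tendsto_nhds_unique (hP 1) (tendsto_const_nhds.congr' (hne.mono fun N hN ↦ by
      simp [hE.apply_cesaroAverage hN, hc0]))
  have hinv : ∀ a, P (α a) = P a := fun a ↦ by
    have h1 := (tendsto_cesaroAverage_apply_sub (norm_automorphismEnd_le α) c).mono_left hl
    have h2 := (hE.continuous.tendsto _).comp (h1.const_mul (α a))
    simp only [mul_zero, map_zero, ZeroMemClass.coe_zero] at h2
    refine (sub_eq_zero.1 (tendsto_nhds_unique ((hP a).sub (hP (α a))) (h2.congr fun N ↦ ?_))).symm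
    rw [Function.comp_apply, mul_sub, map_sub, ← _root_.apply_cesaroAverage, automorphismEnd_apply,
      ← map_mul, hE.2]
    rfl
  -- This gives `‖r • A_N c‖ ≤ 1` for every `N`, so the densities `1 + r • A_N c` are nonnegative.
  let r : ℝ := (‖c‖ + 1)⁻¹
  have hr : 0 < r := by positivity
  let E' : A →ₗ[ℂ] fixedPointSubalgebra α :=
    { toFun a := E a + (r : ℂ) • ⟨P a, hfix a⟩
      map_add' a b := Subtype.ext (by simp [hadd]; abel)
      map_smul' s a := Subtype.ext (by
        simp only [map_smul, hsmul, RingHom.id_apply, SetLike.val_smul, AddMemClass.coe_add, smul_add,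
          smul_comm s (r : ℂ)]) }
  have hE'a : ∀ a, (E' a : A) = E a + (r : ℂ) • P a := fun a ↦ rfl
  have hden : ∀ N, 0 ≤ 1 + (r : ℂ) • cesaroAverage (automorphismEnd α) N c := fun N ↦ by
    set d := (r : ℂ) • cesaroAverage (automorphismEnd α) N c with hd
    have hsa : IsSelfAdjoint d := by
      simp [IsSelfAdjoint, hd, star_cesaroAverage, hc.star_eq]
    have hnorm : ‖d‖ ≤ 1 := by
      rw [hd, norm_smul, Complex.norm_real, Real.norm_of_nonneg hr.le,
        inv_mul_le_iff₀ (by positivity)]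
      linarith [norm_cesaroAverage_le (norm_automorphismEnd_le α) N c]
    have h1 := hsa.neg_algebraMap_norm_le_self
    have h2 : algebraMap ℝ A ‖d‖ ≤ 1 := by
      rw [← _root_.map_one (algebraMap ℝ A)]
      exact algebraMap_mono A hnorm
    calc (0 : A) ≤ 1 - algebraMap ℝ A ‖d‖ := sub_nonneg.2 h2
      _ = 1 + -algebraMap ℝ A ‖d‖ := sub_eq_add_neg _ _
      _ ≤ 1 + d := by gcongr
  have hE' : IsInvariantConditionalExpectation α E' := by
    refine ⟨⟨fun b ↦ Subtype.ext ?_, fun a ha ↦ ?_, fun b a ↦ Subtype.ext ?_,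
      fun a b ↦ Subtype.ext ?_⟩, fun a ↦ Subtype.ext ?_⟩
    · have : P (b : A) = 0 := by simpa [hone] using hmul b 1
      rw [hE'a, hE.1.apply_coe, this, smul_zero, add_zero]
    · refine ge_of_tendsto' (((hP a).const_smul (r : ℂ)).const_add (E a : A)) fun N ↦ ?_
      -- Commutativity is essential here: a product of commuting positive elements is positive.
      have h0 : 0 ≤ a * (1 + (r : ℂ) • cesaroAverage (automorphismEnd α) N c) :=
        Commute.mul_nonneg ha (hden N) (hcomm _ _)
      have := hE.1.nonneg _ h0
      simpa [mul_add] using this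
    · simp [hE'a, hE.1.map_coe_mul, hmul, mul_add]
    · simp [hE'a, hcomm _ (b : A), hE.1.map_coe_mul, hmul, mul_add]
    · simp [hE'a, hE.2, hinv]
  have h0 : P h = 0 := by
    have h1 := hE'a h
    rw [huniq E' hE', left_eq_add] at h1
    exact (smul_eq_zero.1 h1).resolve_left (by exact_mod_cast hr.ne')
  exact h0 ▸ hP h

/-- Reduction to self-adjoint elements through `2 a = (a + a*) - i (i a + (i a)*)`. -/
theorem tendsto_zero (hcomm : ∀ a b : A, a * b = b * a)
    (hE : IsInvariantConditionalExpectation α E)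
    (huniq : ∀ E', IsInvariantConditionalExpectation α E' → E' = E) {l : Filter ℕ} [l.NeBot]
    (hl : l ≤ atTop) {a : A} (ha : E a = 0) (ha' : E (star a) = 0)
    (hconv : ∀ h, ∃ b : A,
      Tendsto (fun N ↦ (E (h * cesaroAverage (automorphismEnd α) N a) : A)) l (𝓝 b))
    (hconv' : ∀ h, ∃ b : A,
      Tendsto (fun N ↦ (E (h * cesaroAverage (automorphismEnd α) N (star a)) : A)) l (𝓝 b))
    (h : A) :
    Tendsto (fun N ↦ (E (h * cesaroAverage (automorphismEnd α) N a) : A)) l (𝓝 0) := by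
  have key : ∀ s : ℂ, Tendsto (fun N ↦ (E (h * cesaroAverage (automorphismEnd α) N
      (s • a + star (s • a))) : A)) l (𝓝 0) := fun s ↦
    tendsto_zero_of_isSelfAdjoint hcomm hE huniq hl (IsSelfAdjoint.add_star_self _)
      (by simp [ha, ha']) (fun h ↦ by
        obtain ⟨b, hb⟩ := hconv h
        obtain ⟨b', hb'⟩ := hconv' h
        exact ⟨_, ((hb.const_smul s).add (hb'.const_smul (star s))).congr fun N ↦ by
          simp [mul_add]⟩) h
  have := ((key 1).sub ((key Complex.I).const_smul Complex.I)).const_smul (2⁻¹ : ℂ)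
  simp only [smul_zero, sub_zero] at this
  refine this.congr fun N ↦ ?_
  simp only [one_smul, star_smul, map_add, map_smul, mul_add, mul_smul_comm, smul_add,
    AddMemClass.coe_add, SetLike.val_smul, smul_smul, smul_sub]
  simp only [RCLike.star_def, Complex.conj_I, mul_neg, Complex.I_mul_I]
  module

end IsInvariantConditionalExpectation

end CStarDynamics

/-! ### Fibre monomials and weighted Koopman operators -/

theorem continuous_coe_zpow (n : ℤ) : Continuous fun z : Circle ↦ ((z ^ n : Circle) : ℂ) := by
  have h : Continuous ((↑) : Circle → ℂ) := by fun_prop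
  exact h.comp (continuous_zpow n)

section Anzai

variable {X : Type*} [TopologicalSpace X]

/-- The weighted Koopman operator `g ↦ fⁿ · (g ∘ θ)` of `C(X)`. -/
noncomputable def weightedKoopman (θ : X ≃ₜ X) (f : C(X, Circle)) (n : ℤ) : C(X, ℂ) →ₗ[ℂ] C(X, ℂ) where
  toFun g := ⟨fun x ↦ ((f x ^ n : Circle) : ℂ) * g (θ x),
    ((continuous_coe_zpow n).comp f.continuous).mul (g.continuous.comp θ.continuous)⟩
  map_add' g h := by ext x; simp [mul_add]
  map_smul' c g := by ext x; simp [mul_left_comm]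

/-- The function `(x, z) ↦ g x * zⁿ` on `X × 𝕋`. -/
noncomputable def fiberMonomial (n : ℤ) : C(X, ℂ) →ₗ[ℂ] C(X × Circle, ℂ) where
  toFun g := ⟨fun p ↦ g p.1 * ((p.2 ^ n : Circle) : ℂ),
    (g.continuous.comp continuous_fst).mul
      ((continuous_coe_zpow n).comp continuous_snd)⟩
  map_add' g h := by ext x; simp [add_mul]
  map_smul' c g := by ext x; simp [mul_assoc]

theorem weightedKoopman_apply (θ : X ≃ₜ X) (f : C(X, Circle)) (n : ℤ) (g : C(X, ℂ)) (x : X) :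
    weightedKoopman θ f n g x = ((f x ^ n : Circle) : ℂ) * g (θ x) := rfl

theorem fiberMonomial_apply (n : ℤ) (g : C(X, ℂ)) (p : X × Circle) :
    fiberMonomial n g p = g p.1 * ((p.2 ^ n : Circle) : ℂ) := rfl

theorem fiberMonomial_zero_one : fiberMonomial 0 (1 : C(X, ℂ)) = 1 := by
  ext p
  simp [fiberMonomial_apply]

theorem fiberMonomial_mul (m n : ℤ) (g h : C(X, ℂ)) :
    fiberMonomial m g * fiberMonomial n h = fiberMonomial (m + n) (g * h) := by
  ext p
  simp only [ContinuousMap.mul_apply, fiberMonomial_apply, zpow_add, Circle.coe_mul]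
  ring

theorem star_fiberMonomial (n : ℤ) (g : C(X, ℂ)) :
    star (fiberMonomial n g) = fiberMonomial (-n) (star g) := by
  ext p
  simp only [ContinuousMap.star_apply, fiberMonomial_apply, star_mul', zpow_neg,
    Circle.coe_inv_eq_conj]
  rfl

/-- The weight is unimodular, so averages of `V` are dominated pointwise by ergodic averages of
`|g|` under `θ`. -/
theorem norm_weightedKoopman_pow_apply (θ : X ≃ₜ X) (f : C(X, Circle)) (n : ℤ) (k : ℕ) (g : C(X, ℂ))
    (x : X) : ‖(weightedKoopman θ f n ^ k) g x‖ = ‖g (θ^[k] x)‖ := by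
  induction k generalizing x with
  | zero => simp
  | succ k ih =>
    rw [pow_succ', Module.End.mul_apply, weightedKoopman_apply, norm_mul, Circle.norm_coe, one_mul,
      ih, Function.iterate_succ_apply]

theorem weightedKoopman_zero_pow_apply (θ : X ≃ₜ X) (f : C(X, Circle)) (k : ℕ) (g : C(X, ℂ))
    (x : X) : (weightedKoopman θ f 0 ^ k) g x = g (θ^[k] x) := by
  induction k generalizing x with
  | zero => simp
  | succ k ih =>
    rw [pow_succ', Module.End.mul_apply, weightedKoopman_apply, ih, Function.iterate_succ_apply]
    simp

theorem weightedKoopman_mul (θ : X ≃ₜ X) (f : C(X, Circle)) (m n : ℤ) (g h : C(X, ℂ)) :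
    weightedKoopman θ f m g * weightedKoopman θ f n h = weightedKoopman θ f (m + n) (g * h) := by
  ext x
  simp only [ContinuousMap.mul_apply, weightedKoopman_apply, zpow_add, Circle.coe_mul]
  ring

theorem star_weightedKoopman (θ : X ≃ₜ X) (f : C(X, Circle)) (n : ℤ) (g : C(X, ℂ)) :
    star (weightedKoopman θ f n g) = weightedKoopman θ f (-n) (star g) := by
  ext x
  simp only [ContinuousMap.star_apply, weightedKoopman_apply, star_mul', zpow_neg,
    Circle.coe_inv_eq_conj]
  rfl

theorem fiberMonomial_injective (n : ℤ) : Function.Injective (fiberMonomial (X := X) n) :=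
  fun g h hgh ↦ ContinuousMap.ext fun x ↦ by
    simpa [fiberMonomial_apply] using DFunLike.congr_fun hgh (x, 1)

/-- Rotation of the fibres of `X × 𝕋` by `t`. -/
noncomputable def fiberRotation (X : Type*) [TopologicalSpace X] (t : Circle) :
    X × Circle ≃ₜ X × Circle :=
  (Homeomorph.refl X).prodCongr (Homeomorph.mulLeft t)

theorem compAutomorphism_fiberRotation_apply (t : Circle) (h : C(X × Circle, ℂ)) (p : X × Circle) :
    compAutomorphism (fiberRotation X t) h p = h (p.1, t * p.2) := rfl

theorem compAutomorphism_fiberRotation_comm (θ : X ≃ₜ X) (f : C(X, Circle)) (t : Circle)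
    (h : C(X × Circle, ℂ)) :
    compAutomorphism (fiberRotation X t) (compAutomorphism (anzaiSkewProduct θ f) h) =
      compAutomorphism (anzaiSkewProduct θ f) (compAutomorphism (fiberRotation X t) h) := by
  ext p
  change h (θ p.1, f p.1 * (t * p.2)) = h (θ p.1, t * (f p.1 * p.2))
  rw [mul_left_comm]

/-- If `n` has no nonzero invariant function for `weightedKoopman θ f n`, nor has `-n`. -/
theorem eq_zero_of_weightedKoopman_neg_eq {θ : X ≃ₜ X} {f : C(X, Circle)} {n : ℤ}
    (h : ∀ u, weightedKoopman θ f n u = u → u = 0) {u : C(X, ℂ)}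
    (hu : weightedKoopman θ f (-n) u = u) : u = 0 := by
  have := star_weightedKoopman θ f (-n) u
  rw [hu, neg_neg] at this
  exact star_eq_zero.1 (h _ this.symm)

variable [CompactSpace X]

theorem norm_weightedKoopman_le (θ : X ≃ₜ X) (f : C(X, Circle)) (n : ℤ) (g : C(X, ℂ)) :
    ‖weightedKoopman θ f n g‖ ≤ ‖g‖ :=
  (ContinuousMap.norm_le _ (norm_nonneg _)).2 fun x ↦ by
    rw [weightedKoopman_apply, norm_mul, Circle.norm_coe, one_mul]
    exact g.norm_coe_le_norm (θ x)

theorem norm_fiberMonomial_le (n : ℤ) (g : C(X, ℂ)) : ‖fiberMonomial n g‖ ≤ ‖g‖ :=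
  (ContinuousMap.norm_le _ (norm_nonneg _)).2 fun p ↦ by
    rw [fiberMonomial_apply, norm_mul, Circle.norm_coe, mul_one]
    exact g.norm_coe_le_norm p.1

theorem continuous_fiberMonomial (n : ℤ) : Continuous (fiberMonomial (X := X) n) :=
  AddMonoidHomClass.continuous_of_bound (fiberMonomial n) 1 fun g ↦ by
    simpa using norm_fiberMonomial_le n g

theorem automorphismEnd_fiberMonomial (θ : X ≃ₜ X) (f : C(X, Circle)) (n : ℤ) (g : C(X, ℂ)) :
    automorphismEnd (compAutomorphism (anzaiSkewProduct θ f)) (fiberMonomial n g) =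
      fiberMonomial n (weightedKoopman θ f n g) := by
  ext p
  change g (θ p.1) * (((f p.1 * p.2) ^ n : Circle) : ℂ) = _
  rw [fiberMonomial_apply, weightedKoopman_apply, mul_zpow, Circle.coe_mul]
  ring

theorem cesaroAverage_fiberMonomial (θ : X ≃ₜ X) (f : C(X, Circle)) (n : ℤ) (N : ℕ) (g : C(X, ℂ)) :
    cesaroAverage (automorphismEnd (compAutomorphism (anzaiSkewProduct θ f))) N
        (fiberMonomial n g) =
      fiberMonomial n (cesaroAverage (weightedKoopman θ f n) N g) :=
  (map_cesaroAverage _ (fun g ↦ (automorphismEnd_fiberMonomial θ f n g).symm) N g).symm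

/-- Stone–Weierstrass: the span is a unital `*`-algebra, degree `1` separates points of a fibre and
degree `0` separates fibres. -/
theorem dense_span_fiberMonomial [T2Space X] :
    Dense (Submodule.span ℂ {h : C(X × Circle, ℂ) | ∃ (n : ℤ) (g : C(X, ℂ)),
      fiberMonomial n g = h} : Set C(X × Circle, ℂ)) := by
  set S : Set C(X × Circle, ℂ) := {h | ∃ (n : ℤ) (g : C(X, ℂ)), fiberMonomial n g = h} with hS
  have hmul : ∀ a ∈ Submodule.span ℂ S, ∀ b ∈ Submodule.span ℂ S,
      a * b ∈ Submodule.span ℂ S := fun a ha b hb ↦ by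
    have h1 := Submodule.mul_mem_mul ha hb
    rw [Submodule.span_mul_span] at h1
    refine Submodule.span_mono ?_ h1
    rintro _ ⟨_, ⟨m, g, rfl⟩, _, ⟨n, h, rfl⟩, rfl⟩
    exact ⟨m + n, g * h, (fiberMonomial_mul m n g h).symm⟩
  have hone : (1 : C(X × Circle, ℂ)) ∈ Submodule.span ℂ S :=
    Submodule.subset_span ⟨0, 1, fiberMonomial_zero_one⟩
  have hstar : ∀ a ∈ Submodule.span ℂ S, star a ∈ Submodule.span ℂ S := fun a ha ↦ by
    induction ha using Submodule.span_induction with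
    | mem x hx =>
      obtain ⟨n, g, rfl⟩ := hx
      exact Submodule.subset_span ⟨-n, star g, (star_fiberMonomial n g).symm⟩
    | zero => simp
    | add x y _ _ hx hy => rw [star_add]; exact add_mem hx hy
    | smul r x _ hx => rw [star_smul]; exact Submodule.smul_mem _ _ hx
  let B : StarSubalgebra ℂ C(X × Circle, ℂ) :=
    { carrier := Submodule.span ℂ S
      mul_mem' {a b} ha hb := hmul a ha b hb
      add_mem' ha hb := add_mem ha hb
      algebraMap_mem' r := by
        rw [Algebra.algebraMap_eq_smul_one]
        exact Submodule.smul_mem _ _ hone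
      star_mem' {a} ha := hstar a ha }
  have hsep : B.SeparatesPoints := by
    rintro ⟨x, z⟩ ⟨y, w⟩ hne
    by_cases hxy : x = y
    · have hzw : z ≠ w := fun h ↦ hne (by rw [hxy, h])
      refine ⟨_, ⟨fiberMonomial 1 1, Submodule.subset_span ⟨1, 1, rfl⟩, rfl⟩, ?_⟩
      simpa [fiberMonomial_apply, Circle.coe_inj] using hzw
    · obtain ⟨g, hgx, hgy, -⟩ := exists_continuous_zero_one_of_isClosed
        (isClosed_singleton (x := x)) (isClosed_singleton (x := y)) (by simpa using hxy)
      refine ⟨_, ⟨fiberMonomial 0 ⟨fun x ↦ (g x : ℂ), by fun_prop⟩,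
        Submodule.subset_span ⟨0, _, rfl⟩, rfl⟩, ?_⟩
      have h0 := hgx rfl
      have h1 := hgy rfl
      simp [fiberMonomial_apply, h0, h1]
  have htop := ContinuousMap.starSubalgebra_topologicalClosure_eq_top_of_separatesPoints B hsep
  intro a
  have : a ∈ B.topologicalClosure := htop ▸ trivial
  exact this

end Anzai

/-! ### From vanishing correlations to uniform convergence -/

theorem ContinuousMap.integrable_of_isFiniteMeasure {X E : Type*} [TopologicalSpace X]
    [CompactSpace X] [MeasurableSpace X] [BorelSpace X] [NormedAddCommGroup E] {μ : Measure X}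
    [IsFiniteMeasure μ] (g : C(X, E)) : Integrable g μ :=
  g.continuous.integrable_of_hasCompactSupport (HasCompactSupport.of_compactSpace _)

theorem IsUniquelyErgodic.integral_comp {X E : Type*} [TopologicalSpace X] [MeasurableSpace X]
    [BorelSpace X] {θ : X ≃ₜ X} {μ : Measure X} [NormedAddCommGroup E] [NormedSpace ℝ E]
    (hμ : IsUniquelyErgodic θ μ) (g : X → E) :
    ∫ x, g (θ x) ∂μ = ∫ x, g x ∂μ := by
  conv_rhs => rw [← hμ.map_eq]
  exact (integral_map_equiv θ.toMeasurableEquiv g).symm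

/-- The variance of `‖k‖` is nonnegative. -/
theorem sq_integral_norm_le {X : Type*} [TopologicalSpace X]
    [CompactSpace X] [MeasurableSpace X] [BorelSpace X] {μ : Measure X} [IsProbabilityMeasure μ]
    (k : C(X, ℂ)) :
    (∫ x, ‖k x‖ ∂μ) ^ 2 ≤ ∫ x, ‖k x‖ ^ 2 ∂μ := by
  set m := ∫ x, ‖k x‖ ∂μ with hm
  have hI : Integrable (fun x ↦ ‖k x‖) μ := k.integrable_of_isFiniteMeasure.norm
  have hI2 : Integrable (fun x ↦ ‖k x‖ ^ 2) μ :=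
    ContinuousMap.integrable_of_isFiniteMeasure ⟨fun x ↦ ‖k x‖ ^ 2, by fun_prop⟩
  have hI3 : Integrable (fun x ↦ ‖k x‖ ^ 2 - (2 * m) * ‖k x‖) μ := hI2.sub (hI.const_mul _)
  have h0 : 0 ≤ ∫ x, (‖k x‖ ^ 2 - (2 * m) * ‖k x‖ + m ^ 2) ∂μ :=
    integral_nonneg fun x ↦ by
      have := sq_nonneg (‖k x‖ - m)
      simp only [Pi.zero_apply]
      linarith
  rw [integral_add hI3 (integrable_const _), integral_sub hI2 (hI.const_mul _),
    integral_const_mul, ← hm] at h0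
  simp only [integral_const, probReal_univ, one_smul] at h0
  linarith

section AnzaiErgodic

variable {X : Type*} [TopologicalSpace X] [CompactSpace X]
  [MeasurableSpace X] [BorelSpace X] {θ : X ≃ₜ X} {μ : Measure X}

/-- If the correlations of `g` with its averages tend to zero, the averages tend to zero in mean
square. -/
theorem IsUniquelyErgodic.tendsto_integral_norm_sq (hμ : IsUniquelyErgodic θ μ) {f : C(X, Circle)}
    {n : ℤ} {g : C(X, ℂ)}
    (h : Tendsto (fun N ↦ ∫ x, (star g * cesaroAverage (weightedKoopman θ f n) N g) x ∂μ)
      atTop (𝓝 0)) :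
    Tendsto (fun N ↦ ∫ x, ‖cesaroAverage (weightedKoopman θ f n) N g x‖ ^ 2 ∂μ) atTop (𝓝 0) := by
  have := hμ.isProbabilityMeasure
  set V := weightedKoopman θ f n with hV
  set S : ℕ → C(X, ℂ) := fun N ↦ ∑ k ∈ Finset.range N, (V ^ k) g with hS
  have hA : ∀ N, cesaroAverage V N g = (N : ℂ)⁻¹ • S N := fun N ↦ cesaroAverage_apply V N g
  have hrec : ∀ N, S (N + 1) = g + V (S N) := fun N ↦ by
    simp only [hS, Finset.sum_range_succ', map_sum, pow_succ', Module.End.mul_apply, pow_zero,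
      Module.End.one_apply]
    rw [add_comm]
  have hint : ∀ k : C(X, ℂ), Integrable (fun x ↦ ‖k x‖ ^ 2) μ := fun k ↦
    ContinuousMap.integrable_of_isFiniteMeasure ⟨fun x ↦ ‖k x‖ ^ 2, by fun_prop⟩
  -- Expand `‖S (N + 1) - g‖² = ‖S N ∘ θ‖²` and integrate, using invariance of `μ`. Division by `N +
  -- 1` turns `S (N + 1)` into an average, so the right side is a correlation plus `O(1/N)`.
  have hstep : ∀ N : ℕ, (∫ x, ‖S (N + 1) x‖ ^ 2 ∂μ - ∫ x, ‖S N x‖ ^ 2 ∂μ) / (N + 1) =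
      2 * (∫ x, (star g * cesaroAverage V (N + 1) g) x ∂μ).re -
        (∫ x, ‖g x‖ ^ 2 ∂μ) * (1 / ((N : ℝ) + 1)) := fun N ↦ by
    have hpt : ∀ x, ‖S (N + 1) x‖ ^ 2 =
        ‖S N (θ x)‖ ^ 2 + 2 * ((star g * S (N + 1)) x).re - ‖g x‖ ^ 2 := fun x ↦ by
      have h1 : ‖S N (θ x)‖ ^ 2 = ‖S (N + 1) x - g x‖ ^ 2 := by
        rw [hrec, ContinuousMap.add_apply, add_sub_cancel_left, hV, weightedKoopman_apply, norm_mul,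
          Circle.norm_coe, one_mul]
      rw [h1]
      simp only [← Complex.normSq_eq_norm_sq, Complex.normSq_apply, ContinuousMap.mul_apply,
        ContinuousMap.star_apply, Complex.sub_re, Complex.sub_im, Complex.mul_re, RCLike.star_def,
        Complex.conj_re, Complex.conj_im]
      ring
    have hI := (star g * S (N + 1)).integrable_of_isFiniteMeasure (μ := μ)
    have hI1 : Integrable (fun x ↦ ‖S N (θ x)‖ ^ 2) μ := hint ((S N).comp θ)
    have hI2 : Integrable (fun x ↦ 2 * ((star g * S (N + 1)) x).re) μ := hI.re.const_mul 2
    have h2 : ∫ x, ((star g * S (N + 1)) x).re ∂μ = (∫ x, (star g * S (N + 1)) x ∂μ).re :=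
      integral_re hI
    have h3 : ∫ x, (star g * cesaroAverage V (N + 1) g) x ∂μ =
        (((N : ℝ) + 1)⁻¹ : ℝ) * ∫ x, (star g * S (N + 1)) x ∂μ := by
      rw [hA, mul_smul_comm, ← integral_const_mul]
      simp
    have hI3 : Integrable (fun x ↦ ‖S N (θ x)‖ ^ 2 + 2 * ((star g * S (N + 1)) x).re) μ :=
      hI1.add hI2
    rw [integral_congr_ae (.of_forall hpt), integral_sub hI3 (hint g),
      integral_add hI1 hI2, integral_const_mul, h2, hμ.integral_comp (fun x ↦ ‖S N x‖ ^ 2), h3,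
      Complex.re_ofReal_mul]
    field_simp
    ring
  have hlim : Tendsto (fun N : ℕ ↦ (∫ x, ‖S (N + 1) x‖ ^ 2 ∂μ - ∫ x, ‖S N x‖ ^ 2 ∂μ) / (N + 1))
      atTop (𝓝 0) := by
    simp only [hstep]
    have h1 := (((Complex.continuous_re.tendsto _).comp
      (h.comp (tendsto_add_atTop_nat 1))).const_mul 2).sub
      ((tendsto_one_div_add_atTop_nhds_zero_nat (𝕜 := ℝ)).const_mul (∫ x, ‖g x‖ ^ 2 ∂μ))
    simpa using h1
  refine (tendsto_div_sq_of_sub_isLittleO (s := fun N ↦ ∫ x, ‖S N x‖ ^ 2 ∂μ) hlim).congr fun N ↦ ?_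
  rw [hA, div_eq_inv_mul, ← integral_const_mul]
  simp [mul_pow]

variable [T2Space X]

/-- In degree `0` the weight `f` disappears, leaving the ergodic averages of `θ`; real and imaginary
parts are treated separately. -/
theorem IsUniquelyErgodic.tendsto_cesaroAverage (hμ : IsUniquelyErgodic θ μ) (f : C(X, Circle))
    (g : C(X, ℂ)) :
    Tendsto (fun N ↦ cesaroAverage (weightedKoopman θ f 0) N g) atTop
      (𝓝 ((∫ x, g x ∂μ) • (1 : C(X, ℂ)))) := by
  have := hμ.isProbabilityMeasure
  have hint := g.integrable_of_isFiniteMeasure (μ := μ)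
  let re : C(X, ℝ) := ⟨fun x ↦ (g x).re, by fun_prop⟩
  let im : C(X, ℝ) := ⟨fun x ↦ (g x).im, by fun_prop⟩
  have hre : ∫ x, re x ∂μ = (∫ x, g x ∂μ).re := integral_re hint
  have him : ∫ x, im x ∂μ = (∫ x, g x ∂μ).im := integral_im hint
  rw [Metric.tendsto_nhds]
  intro ε hε
  filter_upwards [hμ.eventually_forall_abs_lt re (half_pos hε),
    hμ.eventually_forall_abs_lt im (half_pos hε)] with N h1 h2
  rw [ContinuousMap.dist_lt_iff hε]
  intro x
  rw [dist_eq_norm]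
  have hval : cesaroAverage (weightedKoopman θ f 0) N g x =
      ((N : ℝ)⁻¹ : ℝ) * ∑ k ∈ Finset.range N, g (θ^[k] x) := by
    simp [cesaroAverage_apply, weightedKoopman_zero_pow_apply]
  refine (Complex.norm_le_abs_re_add_abs_im _).trans_lt ?_
  have h1 := h1 x
  have h2 := h2 x
  rw [hre] at h1
  rw [him] at h2
  rw [hval]
  simp only [ContinuousMap.smul_apply, ContinuousMap.one_apply, smul_eq_mul, mul_one,
    Complex.sub_re, Complex.sub_im, Complex.re_ofReal_mul, Complex.im_ofReal_mul, Complex.re_sum,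
    Complex.im_sum]
  simp only [re, im, ContinuousMap.coe_mk] at h1 h2
  linarith

/-- Invariant functions of a weighted Koopman operator have constant modulus. -/
theorem IsUniquelyErgodic.exists_star_mul_self_eq (hμ : IsUniquelyErgodic θ μ) {f : C(X, Circle)}
    {n : ℤ} {u : C(X, ℂ)} (hu : weightedKoopman θ f n u = u) (h0 : u ≠ 0) :
    ∃ c : ℂ, c ≠ 0 ∧ star u * u = c • 1 := by
  -- The degrees `-n` and `n` cancel; a fixed function of degree `0` is the limit of its own
  -- averages, hence constant.
  have hinv : weightedKoopman θ f 0 (star u * u) = star u * u := by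
    rw [← neg_add_cancel n, ← weightedKoopman_mul, ← star_weightedKoopman, hu]
  have hc : star u * u = (∫ x, (star u * u) x ∂μ) • 1 :=
    tendsto_nhds_unique (tendsto_const_nhds.congr' ((eventually_ne_atTop 0).mono fun N hN ↦
      (cesaroAverage_of_apply_eq_self hinv hN).symm)) (hμ.tendsto_cesaroAverage f _)
  refine ⟨_, fun h ↦ h0 ?_, hc⟩
  rw [h, zero_smul] at hc
  exact CStarRing.star_mul_self_eq_zero_iff _ |>.1 hc

/-- Constant modulus makes `u` invertible, with inverse `v` a multiple of `star u`. Degree `n` is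
thus reduced to degree `0` by a fixed factor. -/
theorem IsUniquelyErgodic.exists_fiberMonomial_eq (hμ : IsUniquelyErgodic θ μ) {f : C(X, Circle)}
    {n : ℤ} {u : C(X, ℂ)} (hu : weightedKoopman θ f n u = u) (h0 : u ≠ 0) :
    ∃ v : C(X, ℂ), ∀ g, fiberMonomial n g = fiberMonomial n u * fiberMonomial 0 (v * g) := by
  obtain ⟨c, hc, h⟩ := hμ.exists_star_mul_self_eq hu h0
  refine ⟨c⁻¹ • star u, fun g ↦ ?_⟩
  rw [fiberMonomial_mul, add_zero, smul_mul_assoc, mul_smul_comm, ← mul_assoc, mul_comm u, h,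
    smul_mul_assoc, one_mul, smul_smul, inv_mul_cancel₀ hc, one_smul]

/-- If `n` has a nonzero invariant function, the averages of all monomials of degree `n` converge. -/
theorem IsUniquelyErgodic.exists_tendsto_fiberMonomial (hμ : IsUniquelyErgodic θ μ)
    {f : C(X, Circle)} {n : ℤ} {u : C(X, ℂ)} (hu : weightedKoopman θ f n u = u) (h0 : u ≠ 0)
    (g : C(X, ℂ)) : ∃ b, Tendsto (fun N ↦ cesaroAverage
      (automorphismEnd (compAutomorphism (anzaiSkewProduct θ f))) N (fiberMonomial n g))
      atTop (𝓝 b) := by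
  obtain ⟨v, hv⟩ := hμ.exists_fiberMonomial_eq hu h0
  have hfix : compAutomorphism (anzaiSkewProduct θ f) (fiberMonomial n u) = fiberMonomial n u := by
    rw [← automorphismEnd_apply, automorphismEnd_fiberMonomial, hu]
  refine ⟨_, ((((continuous_fiberMonomial 0).tendsto _).comp
    (hμ.tendsto_cesaroAverage f (v * g))).const_mul (fiberMonomial n u)).congr fun N ↦ ?_⟩
  rw [hv g, cesaroAverage_mul_of_fixed hfix, cesaroAverage_fiberMonomial]
  rfl

/-- If the correlations of `g` with its averages tend to zero, the averages tend to zero uniformly. -/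
theorem IsUniquelyErgodic.tendsto_cesaroAverage_zero (hμ : IsUniquelyErgodic θ μ) {f : C(X, Circle)}
    {n : ℤ} {g : C(X, ℂ)}
    (h : Tendsto (fun N ↦ ∫ x, (star g * cesaroAverage (weightedKoopman θ f n) N g) x ∂μ)
      atTop (𝓝 0)) :
    Tendsto (fun N ↦ cesaroAverage (weightedKoopman θ f n) N g) atTop (𝓝 0) := by
  have := hμ.isProbabilityMeasure
  rw [Metric.tendsto_nhds]
  intro ε hε
  -- Fix `M` with `A_M g` small in mean square, hence in `L¹`. Averages of `|A_M g|` under `θ`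
  -- converge uniformly to that small integral.
  obtain ⟨M, hM, hM0⟩ := (((hμ.tendsto_integral_norm_sq h).eventually_lt_const
    (show (0 : ℝ) < (ε / 3) ^ 2 by positivity)).and (eventually_ne_atTop 0)).exists
  set k := cesaroAverage (weightedKoopman θ f n) M g with hk
  have hkint : ∫ x, ‖k x‖ ∂μ < ε / 3 :=
    lt_of_pow_lt_pow_left₀ 2 (by positivity) ((sq_integral_norm_le k).trans_lt hM)
  let w : C(X, ℝ) := ⟨fun x ↦ ‖k x‖, by fun_prop⟩
  have hcl := Metric.tendsto_nhds.1 (tendsto_cesaroAverage_cesaroAverage_sub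
    (norm_weightedKoopman_le θ f n) g hM0) (ε / 3) (by positivity)
  filter_upwards [hcl, hμ.eventually_forall_abs_lt w (show 0 < ε / 3 by positivity)] with N h1 h2
  rw [dist_zero_right] at h1 ⊢
  have h3 : ‖cesaroAverage (weightedKoopman θ f n) N k‖ ≤ ε / 3 + ε / 3 :=
    (ContinuousMap.norm_le _ (by positivity)).2 fun x ↦ by
      have h4 : ‖cesaroAverage (weightedKoopman θ f n) N k x‖ ≤
          (N : ℝ)⁻¹ * ∑ i ∈ Finset.range N, w (θ^[i] x) := by
        simp only [cesaroAverage_apply, ContinuousMap.smul_apply, norm_smul, norm_inv,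
          Complex.norm_natCast, ContinuousMap.sum_apply]
        gcongr
        exact norm_sum_le_of_le _ fun i _ ↦ (norm_weightedKoopman_pow_apply θ f n i k x).le
      have h5 := (abs_lt.1 (h2 x)).2
      have h6 : ∫ y, w y ∂μ < ε / 3 := hkint
      linarith
  have h7 := norm_le_insert (cesaroAverage (weightedKoopman θ f n) N k)
    (cesaroAverage (weightedKoopman θ f n) N g)
  linarith

end AnzaiErgodic

/-! ### Consequences of uniqueness for the skew-product -/

section AnzaiExpectation

variable {X : Type*} [TopologicalSpace X] [CompactSpace X] {θ : X ≃ₜ X} {f : C(X, Circle)}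
  {E : C(X × Circle, ℂ) →ₗ[ℂ] fixedPointSubalgebra (compAutomorphism (anzaiSkewProduct θ f))}

namespace IsInvariantConditionalExpectation

/-- The unique invariant conditional expectation preserves the degree in the fibre variable. -/
theorem exists_apply_fiberMonomial
    (hE : IsInvariantConditionalExpectation (compAutomorphism (anzaiSkewProduct θ f)) E)
    (huniq : ∀ E', IsInvariantConditionalExpectation (compAutomorphism (anzaiSkewProduct θ f)) E' →
      E' = E) (n : ℤ) (g : C(X, ℂ)) :
    ∃ u, weightedKoopman θ f n u = u ∧
      (E (fiberMonomial n g) : C(X × Circle, ℂ)) = fiberMonomial n u := by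
  set F : C(X × Circle, ℂ) := (E (fiberMonomial n g)).1 with hF
  -- Equivariance under rotations gives `F (x, t) = tⁿ F (x, 1)`, so `F` is determined by its values
  -- at `t = 1`.
  let u : C(X, ℂ) := ⟨fun x ↦ F (x, 1), by fun_prop⟩
  have hFu : F = fiberMonomial n u := by
    ext ⟨x, t⟩
    have hrot : compAutomorphism (fiberRotation X t) (fiberMonomial n g) =
        ((t ^ n : Circle) : ℂ) • fiberMonomial n g := by
      ext p
      rw [compAutomorphism_fiberRotation_apply, ContinuousMap.smul_apply, fiberMonomial_apply,
        fiberMonomial_apply, mul_zpow, Circle.coe_mul, smul_eq_mul]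
      ring
    have h1 := hE.apply_commuting_automorphism huniq
      (compAutomorphism_fiberRotation_comm θ f t) (fiberMonomial n g)
    rw [hrot, map_smul, SetLike.val_smul, ← hF] at h1
    have h2 := DFunLike.congr_fun h1 (x, 1)
    rw [compAutomorphism_fiberRotation_apply, ContinuousMap.smul_apply, mul_one, smul_eq_mul] at h2
    rw [← h2, mul_comm]
    rfl
  refine ⟨u, fiberMonomial_injective n ?_, hFu⟩
  rw [← automorphismEnd_fiberMonomial, ← hFu]
  exact (E (fiberMonomial n g)).2

variable [T2Space X] [MeasurableSpace X] [BorelSpace X] {μ : Measure X}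

/-- An invariant conditional expectation integrates functions of the base variable. -/
theorem apply_fiberMonomial_zero
    (hE : IsInvariantConditionalExpectation (compAutomorphism (anzaiSkewProduct θ f)) E)
    (hμ : IsUniquelyErgodic θ μ) (g : C(X, ℂ)) :
    (E (fiberMonomial 0 g) : C(X × Circle, ℂ)) = (∫ x, g x ∂μ) • 1 := by
  have h1 := (hE.continuous.tendsto _).comp
    (((continuous_fiberMonomial 0).tendsto _).comp (hμ.tendsto_cesaroAverage f g))
  rw [map_smul, fiberMonomial_zero_one, map_smul, hE.map_one] at h1
  refine tendsto_nhds_unique (tendsto_const_nhds.congr' ?_) h1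
  filter_upwards [eventually_ne_atTop 0] with N hN
  rw [Function.comp_apply, Function.comp_apply, ← cesaroAverage_fiberMonomial,
    hE.apply_cesaroAverage hN]

/-- Along an ultrafilter, the images of bounded sequences of monomials of a given degree converge. -/
theorem exists_tendsto_fiberMonomial
    (hE : IsInvariantConditionalExpectation (compAutomorphism (anzaiSkewProduct θ f)) E)
    (huniq : ∀ E', IsInvariantConditionalExpectation (compAutomorphism (anzaiSkewProduct θ f)) E' →
      E' = E) (hμ : IsUniquelyErgodic θ μ) (𝒰 : Ultrafilter ℕ) (n : ℤ) {k : ℕ → C(X, ℂ)} {C : ℝ}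
    (hk : ∀ N, ‖k N‖ ≤ C) :
    ∃ b : C(X × Circle, ℂ),
      Tendsto (fun N ↦ (E (fiberMonomial n (k N)) : C(X × Circle, ℂ))) 𝒰 (𝓝 b) := by
  -- `E` has rank at most one on degree `n`: it sends `g zⁿ` to `(∫ v g) u zⁿ`, or to `0` if no such
  -- `u` exists. Convergence of bounded scalars is therefore enough.
  by_cases h : ∃ u, weightedKoopman θ f n u = u ∧ u ≠ 0
  · obtain ⟨u, hu, hu0⟩ := h
    obtain ⟨v, hv⟩ := hμ.exists_fiberMonomial_eq hu hu0
    have := hμ.isProbabilityMeasure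
    have hfix : fiberMonomial n u ∈
        fixedPointSubalgebra (compAutomorphism (anzaiSkewProduct θ f)) := by
      rw [mem_fixedPointSubalgebra, ← automorphismEnd_apply, automorphismEnd_fiberMonomial, hu]
    have hbd : ∀ N, ∫ x, (v * k N) x ∂μ ∈ Metric.closedBall (0 : ℂ) (‖v‖ * C) := fun N ↦ by
      rw [mem_closedBall_zero_iff]
      refine (norm_integral_le_of_norm_le_const (C := ‖v‖ * C) (.of_forall fun x ↦ ?_)).trans
        (by simp)
      exact ((v * k N).norm_coe_le_norm x).trans ((norm_mul_le _ _).trans (by gcongr; exact hk N))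
    obtain ⟨z, -, hz⟩ := 𝒰.exists_tendsto_of_forall_mem (isCompact_closedBall _ _) hbd
    refine ⟨_, ((hz.smul_const (1 : C(X × Circle, ℂ))).const_mul (fiberMonomial n u)).congr
      fun N ↦ ?_⟩
    rw [hv (k N), ← hE.apply_fiberMonomial_zero hμ]
    exact congrArg Subtype.val (hE.1.map_coe_mul ⟨_, hfix⟩ _).symm
  · push Not at h
    refine ⟨0, tendsto_const_nhds.congr fun N ↦ ?_⟩
    obtain ⟨u, hu, hEu⟩ := hE.exists_apply_fiberMonomial huniq n (k N)
    rw [hEu, h u hu, map_zero]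

/-- Along an ultrafilter, `E (h * A_N a)` converges for every monomial `a`. -/
theorem exists_tendsto_mul_cesaroAverage
    (hE : IsInvariantConditionalExpectation (compAutomorphism (anzaiSkewProduct θ f)) E)
    (huniq : ∀ E', IsInvariantConditionalExpectation (compAutomorphism (anzaiSkewProduct θ f)) E' →
      E' = E) (hμ : IsUniquelyErgodic θ μ) (𝒰 : Ultrafilter ℕ) (n : ℤ) (g : C(X, ℂ))
    (h : C(X × Circle, ℂ)) :
    ∃ b : C(X × Circle, ℂ), Tendsto (fun N ↦ (E (h * cesaroAverage
      (automorphismEnd (compAutomorphism (anzaiSkewProduct θ f))) N (fiberMonomial n g)) :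
        C(X × Circle, ℂ))) 𝒰 (𝓝 b) := by
  set α := compAutomorphism (anzaiSkewProduct θ f) with hα
  have hA : ∀ N, ‖cesaroAverage (automorphismEnd α) N (fiberMonomial n g)‖ ≤ ‖g‖ := fun N ↦
    (norm_cesaroAverage_le (norm_automorphismEnd_le α) N _).trans (norm_fiberMonomial_le n g)
  refine hE.exists_tendsto_apply_mul hA dense_span_fiberMonomial ?_ h
  rintro _ ⟨m, g', rfl⟩
  have hk : ∀ N, ‖g' * cesaroAverage (weightedKoopman θ f n) N g‖ ≤ ‖g'‖ * ‖g‖ := fun N ↦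
    (norm_mul_le _ _).trans (by
      gcongr
      exact norm_cesaroAverage_le (norm_weightedKoopman_le θ f n) N g)
  obtain ⟨b, hb⟩ := hE.exists_tendsto_fiberMonomial huniq hμ 𝒰 (m + n) hk
  refine ⟨b, hb.congr fun N ↦ ?_⟩
  rw [hα, cesaroAverage_fiberMonomial, fiberMonomial_mul]

/-- Without nonzero invariant functions of degree `n`, uniqueness of the invariant conditional
expectation forces the averages of monomials of degree `n` to vanish in the limit. -/
theorem tendsto_cesaroAverage_zero
    (hE : IsInvariantConditionalExpectation (compAutomorphism (anzaiSkewProduct θ f)) E)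
    (huniq : ∀ E', IsInvariantConditionalExpectation (compAutomorphism (anzaiSkewProduct θ f)) E' →
      E' = E) (hμ : IsUniquelyErgodic θ μ) {n : ℤ}
    (h0 : ∀ u, weightedKoopman θ f n u = u → u = 0) (g : C(X, ℂ)) :
    Tendsto (fun N ↦ cesaroAverage (weightedKoopman θ f n) N g) atTop (𝓝 0) := by
  refine hμ.tendsto_cesaroAverage_zero (tendsto_iff_ultrafilter _ _ _ |>.2 fun 𝒰 h𝒰 ↦ ?_)
  have hzero : ∀ {m : ℤ}, (∀ u, weightedKoopman θ f m u = u → u = 0) → ∀ g,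
      E (fiberMonomial m g) = 0 := fun {m} hm g ↦ by
    obtain ⟨u, hu, hEu⟩ := hE.exists_apply_fiberMonomial huniq m g
    rw [hm u hu, map_zero] at hEu
    exact Subtype.ext hEu
  have hlim := hE.tendsto_zero mul_comm huniq h𝒰 (hzero h0 g)
    (by
      rw [star_fiberMonomial]
      exact hzero (fun u hu ↦ eq_zero_of_weightedKoopman_neg_eq h0 hu) _)
    (hE.exists_tendsto_mul_cesaroAverage huniq hμ 𝒰 n g)
    (by
      rw [star_fiberMonomial]
      exact hE.exists_tendsto_mul_cesaroAverage huniq hμ 𝒰 (-n) (star g))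
    -- With this `h` the product has degree `0`, where `E` is integration against `μ`; the limit is
    -- then exactly the correlation.
    (star (fiberMonomial n g))
  simp only [cesaroAverage_fiberMonomial, star_fiberMonomial, fiberMonomial_mul, neg_add_cancel,
    hE.apply_fiberMonomial_zero hμ] at hlim
  have := hμ.isProbabilityMeasure
  obtain ⟨x⟩ : Nonempty X := μ.nonempty_of_neZero
  simpa [Function.comp_def] using
    ((continuous_eval_const (x, (1 : Circle))).tendsto _).comp hlim

end IsInvariantConditionalExpectation

end AnzaiExpectation

theorem mainTheorem1 {X : Type*} [TopologicalSpace X] [CompactSpace X] [T2Space X]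
    [MeasurableSpace X] [BorelSpace X] (θ : X ≃ₜ X) (μ : Measure X)
    (hμ : IsUniquelyErgodic θ μ) (f : C(X, Circle)) :
    IsUniquelyErgodicRelFixedPoints (compAutomorphism (anzaiSkewProduct θ f)) ↔
      ∃! E : C(X × Circle, ℂ) →ₗ[ℂ]
          fixedPointSubalgebra (compAutomorphism (anzaiSkewProduct θ f)),
        IsInvariantConditionalExpectation (compAutomorphism (anzaiSkewProduct θ f)) E := by
  refine ⟨fun h ↦ h.existsUnique, fun ⟨E, hE, huniq⟩ ↦ ?_⟩
  rw [isUniquelyErgodicRelFixedPoints_iff]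
  refine exists_tendsto_of_dense_span (C := 1) (fun N a ↦ ?_) dense_span_fiberMonomial ?_
  · rw [one_mul]
    exact norm_cesaroAverage_le (norm_automorphismEnd_le _) N a
  · rintro _ ⟨n, g, rfl⟩
    by_cases h : ∃ u, weightedKoopman θ f n u = u ∧ u ≠ 0
    · obtain ⟨u, hu, hu0⟩ := h
      exact hμ.exists_tendsto_fiberMonomial hu hu0 g
    · push Not at h
      simp only [cesaroAverage_fiberMonomial]
      exact ⟨_, ((continuous_fiberMonomial n).tendsto _).comp
        (hE.tendsto_cesaroAverage_zero huniq hμ h g)⟩
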